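/- Let $\Bbbk$ be a field of characteristic zero, let $n\ge 1$, and let $R=\Bbbk[x_1,\dots,x_n]$ with the standard grading. Let $d_1,\dots,d_n$ be nonnegative integers and let $\alpha_1,\dots,\alpha_n$ be integers such that $0\le\alpha_i\le d_i$ for all $i$ and $d_1=\alpha_2+\dots+\alpha_n$. Let $c\in\Bbbk$ be nonzero, with $c\neq-1$ in case $d_1=0$ (so that the binomial below is not the zero polynomial), and define the ideal \[K'=(x_1^{d_1}+c\,x_2^{\alpha_2}\cdots x_n^{\alpha_n},\,x_2^{d_2},\dots,x_n^{d_n})+x_1^{d_1-\alpha_1}(x_2^{d_2-\alpha_2},\dots,x_n^{d_n-\alpha_n}).\] Then, unless $K'=R$, the ring $R/K'$ is Gorenstein and has the strong Lefschetz property (SLP). Here a graded quotient $A=R/I$ by a homogeneous ideal $I$ has the SLP if $A$ is Artinian and there is a linear form $\ell\in A_1$ such that for all $e,i\ge 0$ the multiplication map $\ell^e\colon A_i\to A_{i+e}$ has maximal rank, i.e. is injective or surjective. -/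

import Mathlib

universe u v

attribute [local instance] MvPolynomial.gradedAlgebra

/-- A commutative ring is Gorenstein if it is Noetherian and each of its localizations at a prime
ideal has finite injective dimension as a module over itself. -/
def IsGorensteinRing (A : Type u) [CommRing A] : Prop :=
  IsNoetherianRing A ∧
    ∀ (P : Ideal A) [P.IsPrime], ∃ m : ℕ,
      CategoryTheory.HasInjectiveDimensionLE
        (ModuleCat.of (Localization.AtPrime P) (Localization.AtPrime P)) m

/-- The degree `i` component of the quotient of a standard graded polynomial ring by a
homogeneous ideal `I`: the set of classes of forms of degree `i`. -/
noncomputable def quotientComponent {σ : Type v} {k : Type u} [Field k]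
    (I : Ideal (MvPolynomial σ k)) (i : ℕ) : Submodule k (MvPolynomial σ k ⧸ I) :=
  (MvPolynomial.homogeneousSubmodule σ k i).map (Ideal.Quotient.mkₐ k I).toLinearMap

/-- The strong Lefschetz property of the algebra `A = k[x_j : j ∈ σ] / I`: the ideal `I` is
homogeneous, `A` is Artinian, and there is a linear form `ℓ` such that, for all `e` and `i`,
multiplication by `ℓ ^ e` from `A_i` to `A_{i+e}` has maximal rank, that is, it is injective or
surjective. -/
structure HasSLP {σ : Type v} {k : Type u} [Field k] (I : Ideal (MvPolynomial σ k)) : Prop where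
  homogeneous : I.IsHomogeneous (MvPolynomial.homogeneousSubmodule σ k)
  artinian : IsArtinianRing (MvPolynomial σ k ⧸ I)
  exists_lefschetz : ∃ l ∈ quotientComponent I 1, ∀ e i : ℕ,
    Set.InjOn (fun a => l ^ e * a) (quotientComponent I i) ∨
      Set.SurjOn (fun a => l ^ e * a) (quotientComponent I i) (quotientComponent I (i + e))

/-- The ideal
`(x_1^{d_1} + c x_2^{α_2} ⋯ x_n^{α_n}, x_2^{d_2}, …, x_n^{d_n})
  + x_1^{d_1-α_1} (x_2^{d_2-α_2}, …, x_n^{d_n-α_n})`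
of `k[x_1, …, x_n]`, where `n = m + 1`, the variable `x_1` is `X 0` and the variables
`x_2, …, x_n` are the `X j.succ` with `j : Fin m`. -/
noncomputable def binomialIdeal {k : Type u} [Field k] {m : ℕ} (d α : Fin (m + 1) → ℕ) (c : k) :
    Ideal (MvPolynomial (Fin (m + 1)) k) :=
  Ideal.span
      ({MvPolynomial.X 0 ^ d 0 +
          MvPolynomial.C c * ∏ j : Fin m, MvPolynomial.X j.succ ^ α j.succ} ∪
        Set.range fun j : Fin m => MvPolynomial.X j.succ ^ d j.succ) +
    Ideal.span {MvPolynomial.X 0 ^ (d 0 - α 0)} *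
      Ideal.span (Set.range fun j : Fin m => MvPolynomial.X j.succ ^ (d j.succ - α j.succ))

/-!
Modulo the binomial, powers of `x_1` beyond `d_1` are traded for the other variables, and the
quotient has a `k`-basis of monomials whose exponents fill two boxes, with centres in the same
degree. A functional read off from the inverse system pairs each basis monomial with its reflection
in the centre of its box and with nothing else, so the multiplication form is nondegenerate and the
quotient is self-injective.

Each of `x_2, …, x_n` acts on the basis as a unit shift of the boxes. So does `x_1`, up to a term
that sends the top layer of a box back into bottom layers. Rescaling the basis by powers of a
parameter `μ` according to the `x_1`-coordinate inside the box makes this term tend to zero, so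
that `x_2 + ⋯ + x_n + μ x_1` degenerates to the sum of all unit shifts. That sum is the raising
operator of an `sl₂`-triple whose weights are the degrees centred at half the socle degree, hence
its powers are injective where required; injectivity is an open condition, so it persists for some
`μ ≠ 0`.
-/

section SlTwo

open LieModule

variable {R L M : Type*} [CommRing R] [LieRing L] [LieAlgebra R L] [AddCommGroup M] [Module R M]
  [LieRingModule L M] [LieModule R L M] {h e f : L} {v : M}

lemma pow_toEnd_e_lie_f_eq_zero (t : IsSl2Triple h e f) {μ : R} (hv : ⁅h, v⁆ = μ • v) {n : ℕ}
    (he : (toEnd R L M e ^ n) v = 0) : (toEnd R L M e ^ (n + 1)) ⁅f, v⁆ = 0 := by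
  induction n generalizing v μ with
  | zero =>
    obtain rfl : v = 0 := by simpa using he
    simp
  | succ n ih =>
    have hev : ⁅h, ⁅e, v⁆⁆ = (μ + 2) • ⁅e, v⁆ := by
      simpa using t.lie_h_pow_toEnd_e hv 1
    rw [pow_succ, Module.End.mul_apply, toEnd_apply_apply] at he ⊢
    rw [leibniz_lie e f v, t.lie_e_f, hv, map_add, ih hev he, map_smul, pow_succ,
      Module.End.mul_apply, toEnd_apply_apply, he, smul_zero, add_zero]

lemma pow_add_toEnd_e_pow_toEnd_f_eq_zero (t : IsSl2Triple h e f) {μ : R} (hv : ⁅h, v⁆ = μ • v)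
    {n : ℕ} (he : (toEnd R L M e ^ n) v = 0) (b : ℕ) :
    (toEnd R L M e ^ (n + b)) ((toEnd R L M f ^ b) v) = 0 := by
  induction b with
  | zero => simpa using he
  | succ b ih =>
    have hw : ⁅h, (toEnd R L M f ^ b) v⁆ = (μ - 2 * b) • (toEnd R L M f ^ b) v := by
      have := t.symm.lie_h_pow_toEnd_e (m := v) (μ := -μ) (R := R) (by simp [hv]) b
      rw [neg_lie, neg_eq_iff_eq_neg, ← neg_smul] at this
      rw [this, neg_add, neg_neg, sub_eq_add_neg]
    rw [pow_succ' (toEnd R L M f), Module.End.mul_apply, toEnd_apply_apply]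
    exact pow_toEnd_e_lie_f_eq_zero t hw ih

lemma exists_hasPrimitiveVectorWith_pow_toEnd_e
    [IsDomain R] [CharZero R] [Module.IsTorsionFree R M] [Module.Finite R M]
    (t : IsSl2Triple h e f) (hv0 : v ≠ 0) {μ : R} (hv : ⁅h, v⁆ = μ • v) :
    ∃ b : ℕ, t.HasPrimitiveVectorWith ((toEnd R L M e ^ b) v) (μ + 2 * b) := by
  obtain ⟨b, hb, hb'⟩ : ∃ b : ℕ, (toEnd R L M e ^ b) v ≠ 0 ∧ (toEnd R L M e ^ (b + 1)) v = 0 := by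
    refine Nat.exists_not_and_succ_of_not_zero_of_exists
      (p := fun b => (toEnd R L M e ^ b) v = 0) (by simpa using hv0) ?_
    by_contra! hne
    have hinj : Function.Injective fun b : ℕ => μ + 2 * (b : R) := fun a b hab => by
      simpa using hab
    have hli := Module.End.eigenvectors_linearIndependent' (toEnd R L M h) _ hinj
      (fun b => (toEnd R L M e ^ b) v)
      fun b => ⟨Module.End.mem_eigenspace_iff.2 (t.lie_h_pow_toEnd_e hv b), hne b⟩
    exact not_finite_iff_infinite.2 (inferInstance : Infinite ℕ) hli.finite
  exact ⟨b, hb, t.lie_h_pow_toEnd_e hv b, by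
    rwa [pow_succ', Module.End.mul_apply, toEnd_apply_apply] at hb'⟩

theorem eq_zero_of_pow_toEnd_e_eq_zero
    [IsDomain R] [CharZero R] [Module.IsTorsionFree R M] [Module.Finite R M]
    (t : IsSl2Triple h e f) {n : ℕ} (hv : ⁅h, v⁆ = -(n : R) • v)
    (he : (toEnd R L M e ^ n) v = 0) : v = 0 := by
  by_contra hv0
  obtain ⟨b, hb⟩ := exists_hasPrimitiveVectorWith_pow_toEnd_e (R := R) t.symm hv0
    (μ := n) (by rw [neg_lie, hv, neg_smul, neg_neg])
  refine hb.pow_toEnd_f_ne_zero_of_eq_nat (n := n + 2 * b) (i := n + b) (by push_cast; rfl)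
    (by lia) ?_
  exact pow_add_toEnd_e_pow_toEnd_f_eq_zero t hv he b

end SlTwo

section Degeneration

open LinearMap Polynomial

variable {k V W S T : Type*} [Field k] [AddCommGroup V] [Module k V] [AddCommGroup W] [Module k W]
  [Fintype S] [DecidableEq S]

lemma exists_ne_zero_forall_eval_ne_zero_disjoint_ker [Finite T]
    (b : Module.Basis S k V) (b' : Module.Basis T k W) (A : Matrix T S k[X]) {U : Submodule k V}
    {a : k} (ha : Disjoint U (ker (Matrix.toLin b b' (A.map (eval a))))) :
    ∃ p : k[X], p ≠ 0 ∧
      ∀ μ, eval μ p ≠ 0 → Disjoint U (ker (Matrix.toLin b b' (A.map (eval μ)))) := by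
  classical
  have := Fintype.ofFinite T
  have := Module.Finite.of_basis b
  let f (μ : k) : U →ₗ[k] W := (Matrix.toLin b b' (A.map (eval μ))).domRestrict U
  obtain ⟨g, hg⟩ := exists_leftInverse_of_injective (f a)
    (ker_eq_bot_of_injective (injective_domRestrict_iff.2 ha))
  let bU := Module.finBasis k U
  let p : k[X] := ((toMatrix b' bU g).map C * A * (toMatrix bU b U.subtype).map C).det
  have hp (μ : k) : eval μ p = LinearMap.det (g ∘ₗ f μ) := by
    have hC : (evalRingHom μ : k[X] → k) ∘ C = _root_.id := by ext; simp
    rw [← det_toMatrix bU, toMatrix_comp bU b' bU, show f μ = _ ∘ₗ U.subtype from rfl,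
      toMatrix_comp bU b b', toMatrix_toLin,
      ← coe_evalRingHom, RingHom.map_det, ← Matrix.mul_assoc]
    simp only [RingHom.mapMatrix_apply, Matrix.map_mul, Matrix.map_map, hC, Matrix.map_id]
  refine ⟨p, fun hp0 => ?_, fun μ hμ => injective_domRestrict_iff.1 ?_⟩
  · simpa [hg, hp0] using hp a
  · rw [hp] at hμ
    exact Function.Injective.of_comp (f := g) (equivOfDetNeZero _ hμ).injective

lemma exists_ne_zero_forall_disjoint_ker [Infinite k] (b : Module.Basis S k V) {ι : Type*}
    (J : Finset ι) (A : ι → Matrix S S k[X]) (U : ι → Submodule k V) {a : k}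
    (ha : ∀ j ∈ J, Disjoint (U j) (ker (Matrix.toLin b b ((A j).map (eval a))))) :
    ∃ μ : k, μ ≠ 0 ∧ ∀ j ∈ J, Disjoint (U j) (ker (Matrix.toLin b b ((A j).map (eval μ)))) := by
  choose! p hp0 hp using fun j hj =>
    exists_ne_zero_forall_eval_ne_zero_disjoint_ker b b (A j) (ha j hj)
  have hP : X * ∏ j ∈ J, p j ≠ 0 := mul_ne_zero X_ne_zero (Finset.prod_ne_zero_iff.2 hp0)
  obtain ⟨μ, hμ⟩ : ∃ μ, eval μ (X * ∏ j ∈ J, p j) ≠ 0 := by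
    by_contra! h
    exact hP (Polynomial.funext fun μ => by rw [h μ, eval_zero])
  rw [eval_mul, eval_X, eval_prod] at hμ
  exact ⟨μ, left_ne_zero_of_mul hμ, fun j hj =>
    hp j hj μ (Finset.prod_ne_zero_iff.1 (right_ne_zero_of_mul hμ) j hj)⟩

lemma disjoint_span_ker_of_semiconjBy_diagonal (b : Module.Basis S k V) {a : S → k}
    (ha : ∀ s, a s ≠ 0) {f g : Module.End k V}
    (h : SemiconjBy (Matrix.toLin b b (Matrix.diagonal a)) f g) {P : Set S}
    (hf : Disjoint (Submodule.span k (b '' P)) (ker f)) :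
    Disjoint (Submodule.span k (b '' P)) (ker g) := by
  set D : Module.End k V := Matrix.toLin b b (Matrix.diagonal a)
  have hDb (s : S) : D (b s) = a s • b s := by
    simp [D, Matrix.toLin_self, Matrix.diagonal_apply, ite_smul]
  have hDinj : Function.Injective D :=
    ((Module.End.isUnit_iff D).1 <| IsUnit.map (Matrix.toLinAlgEquiv b) <|
      Matrix.isUnit_diagonal.2 <| Pi.isUnit_iff.2 fun s => (ha s).isUnit).1
  have hDspan : Submodule.span k (b '' P) ≤ (Submodule.span k (b '' P)).map D := by
    rw [Submodule.span_le, Set.image_subset_iff]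
    intro s hs
    refine ⟨(a s)⁻¹ • b s, Submodule.smul_mem _ _ (Submodule.subset_span ⟨s, hs, rfl⟩), ?_⟩
    rw [map_smul, hDb, inv_smul_smul₀ (ha s)]
  rw [disjoint_ker] at hf ⊢
  intro x hx hgx
  obtain ⟨y, hy, rfl⟩ := hDspan hx
  have hDf : D (f y) = 0 := (LinearMap.congr_fun h.eq y).trans hgx
  rw [hf y hy (hDinj (hDf.trans (map_zero D).symm)), map_zero]

/-- Conjugation by the diagonal matrix `μ ^ w s` multiplies the `(t, s)` entry by
`μ ^ (w t - w s)`; hence the exponent of the entries of `Z`, which do not raise the weight `w`. -/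
lemma semiconjBy_diagonal_pow_weight {Y R Z : Matrix S S k} {w : S → ℕ}
    (hY : ∀ s t, Y t s ≠ 0 → w t = w s) (hR : ∀ s t, R t s ≠ 0 → w t = w s + 1)
    (hZ : ∀ s t, Z t s ≠ 0 → w t ≤ w s) (μ : k) :
    SemiconjBy (Matrix.diagonal fun s => μ ^ w s)
      (Y + R + Matrix.of fun t s => Z t s * μ ^ (w s + 1 - w t)) (Y + μ • (R + Z)) := by
  ext t s
  simp only [Matrix.diagonal_mul, Matrix.mul_diagonal, Matrix.add_apply, Matrix.smul_apply,
    Matrix.of_apply, smul_eq_mul]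
  have hYts : μ ^ w t * Y t s = Y t s * μ ^ w s := by
    by_cases h : Y t s = 0
    · simp [h]
    · rw [hY s t h, mul_comm]
  have hRts : μ ^ w t * R t s = μ * R t s * μ ^ w s := by
    by_cases h : R t s = 0
    · simp [h]
    · rw [hR s t h]; ring
  have hZts : μ ^ w t * (Z t s * μ ^ (w s + 1 - w t)) = μ * Z t s * μ ^ w s := by
    by_cases h : Z t s = 0
    · simp [h]
    · calc μ ^ w t * (Z t s * μ ^ (w s + 1 - w t))
          = Z t s * μ ^ (w t + (w s + 1 - w t)) := by rw [pow_add]; ring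
        _ = μ * Z t s * μ ^ w s := by
          rw [Nat.add_sub_cancel' ((hZ s t h).trans (w s).le_succ), pow_succ]; ring
  linear_combination hYts + hRts + hZts

omit [Fintype S] [DecidableEq S] in
theorem exists_disjoint_ker_pow_of_weight [Finite S] [Infinite k] (b : Module.Basis S k V)
    (w : S → ℕ) {Y R Z : Module.End k V}
    (hY : ∀ s t, b.repr (Y (b s)) t ≠ 0 → w t = w s)
    (hR : ∀ s t, b.repr (R (b s)) t ≠ 0 → w t = w s + 1)
    (hZ : ∀ s t, b.repr (Z (b s)) t ≠ 0 → w t ≤ w s)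
    {ι : Type*} (J : Finset ι) (e : ι → ℕ) (P : ι → Set S)
    (h : ∀ j ∈ J, Disjoint (Submodule.span k (b '' P j)) (ker ((Y + R) ^ e j))) :
    ∃ μ : k, μ ≠ 0 ∧
      ∀ j ∈ J, Disjoint (Submodule.span k (b '' P j)) (ker ((Y + μ • (R + Z)) ^ e j)) := by
  classical
  have := Fintype.ofFinite S
  simp only [← toMatrix_apply b b] at hY hR hZ
  let N : Matrix S S k[X] := (toMatrix b b (Y + R)).map C +
    Matrix.of fun t s => C (toMatrix b b Z t s) * X ^ (w s + 1 - w t)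
  have hN (μ : k) : N.map (eval μ) = toMatrix b b Y + toMatrix b b R +
      Matrix.of fun t s => toMatrix b b Z t s * μ ^ (w s + 1 - w t) := by
    ext t s
    simp [N]
  have hNpow (μ : k) (n : ℕ) :
      Matrix.toLin b b ((N ^ n).map (eval μ)) = Matrix.toLin b b (N.map (eval μ)) ^ n := by
    rw [← Matrix.toLin_pow]
    exact congrArg _ (map_pow (evalRingHom μ).mapMatrix N n)
  have hN0 : Matrix.toLin b b (N.map (eval 0)) = Y + R := by
    suffices N.map (eval 0) = toMatrix b b (Y + R) by rw [this, Matrix.toLin_toMatrix]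
    rw [hN, map_add, add_eq_left]
    ext t s
    by_cases hts : toMatrix b b Z t s = 0
    · simp [hts]
    · have := hZ s t hts
      simp [zero_pow (show w s + 1 - w t ≠ 0 by lia)]
  obtain ⟨μ, hμ, H⟩ := exists_ne_zero_forall_disjoint_ker b J (fun j => N ^ e j)
    (fun j => Submodule.span k (b '' P j)) (a := 0) (by simpa only [hNpow, hN0] using h)
  refine ⟨μ, hμ, fun j hj => ?_⟩
  have hconj : SemiconjBy (Matrix.toLin b b (Matrix.diagonal fun s => μ ^ w s))
      (Matrix.toLin b b (N.map (eval μ))) (Y + μ • (R + Z)) := by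
    have := (semiconjBy_diagonal_pow_weight hY hR hZ μ).map (Matrix.toLinAlgEquiv b)
    rw [← hN, ← map_add, ← map_smul, ← map_add] at this
    rwa [← Matrix.toLin_toMatrix b b (Y + _)]
  exact disjoint_span_ker_of_semiconjBy_diagonal b (fun s => pow_ne_zero _ hμ)
    (hconj.pow_right (e j)) (by simpa only [hNpow] using H j hj)

end Degeneration

section Gorenstein

variable {k A : Type*} [Field k] [CommRing A] [Algebra k A] {φ : A →ₗ[k] k}

lemma baer_self_of_nondegenerate [FiniteDimensional k A]
    (hφ : ∀ a, (∀ b, φ (a * b) = 0) → a = 0) : Module.Baer A A := by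
  intro I g
  let Φ : A →ₗ[k] Module.Dual k A := (LinearMap.mul k A).compr₂ φ
  have hΦ : Function.Injective Φ :=
    (injective_iff_map_eq_zero Φ).2 fun a ha => hφ a fun b => LinearMap.congr_fun ha b
  have hΦ_surj : Function.Surjective Φ :=
    (LinearMap.injective_iff_surjective_of_finrank_eq_finrank
      Subspace.dual_finrank_eq.symm).1 hΦ
  obtain ⟨ψ, hψ⟩ := LinearMap.exists_extend (p := I.restrictScalars k)
    (φ ∘ₗ (g.restrictScalars k : I.restrictScalars k →ₗ[k] A))
  obtain ⟨b, hb⟩ := hΦ_surj ψ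
  refine ⟨LinearMap.mulLeft A b, fun x hx => ?_⟩
  rw [LinearMap.mulLeft_apply, ← sub_eq_zero]
  refine hφ _ fun y => ?_
  have hg : g (y • ⟨x, hx⟩) = y * g ⟨x, hx⟩ := g.map_smul y ⟨x, hx⟩
  have hφ_mul : φ (b * (x * y)) = φ (g ⟨x, hx⟩ * y) :=
    calc φ (b * (x * y)) = ψ (y * x) := by rw [← hb, mul_comm x y]; rfl
      _ = φ (g (y • ⟨x, hx⟩)) := LinearMap.congr_fun hψ (y • ⟨x, hx⟩)
      _ = φ (g ⟨x, hx⟩ * y) := by rw [hg, mul_comm]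
  rw [sub_mul, map_sub, mul_assoc, hφ_mul, sub_self]

theorem isGorensteinRing_of_nondegenerate [FiniteDimensional k A]
    (hφ : ∀ a, (∀ b, φ (a * b) = 0) → a = 0) : IsGorensteinRing A := by
  have hN : IsNoetherianRing A := IsNoetherianRing.of_finite k A
  refine ⟨hN, fun P _ => ⟨0, ?_⟩⟩
  have hA : Module.Injective A A := (baer_self_of_nondegenerate hφ).injective
  have hAP := Module.injective_of_isLocalizedModule (Rₛ := Localization.AtPrime P) P.primeCompl
    (Algebra.linearMap A (Localization.AtPrime P))
  rwa [Module.injective_iff_injective_object,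
    CategoryTheory.injective_iff_hasInjectiveDimensionLT_one] at hAP

variable {ι : Type*} {b b' : ι → A}

lemma apply_linearCombination_mul (hne : ∀ s t, s ≠ t → φ (b s * b' t) = 0) (l : ι →₀ k) (t : ι) :
    φ (Finsupp.linearCombination k b l * b' t) = l t * φ (b t * b' t) := by
  rw [Finsupp.linearCombination_apply, Finsupp.sum, Finset.sum_mul, map_sum,
    Finset.sum_eq_single t (fun s _ hst => ?_) fun ht => ?_]
  · rw [smul_mul_assoc, map_smul, smul_eq_mul]
  · rw [smul_mul_assoc, map_smul, hne s t hst, smul_zero]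
  · rw [Finsupp.notMem_support_iff.1 ht, zero_smul, zero_mul, map_zero]

lemma linearIndependent_of_dual_family (hne : ∀ s t, s ≠ t → φ (b s * b' t) = 0)
    (hself : ∀ s, φ (b s * b' s) ≠ 0) : LinearIndependent k b := by
  refine linearIndependent_iff.2 fun l hl => Finsupp.ext fun t => ?_
  have h := apply_linearCombination_mul hne l t
  rw [hl, zero_mul, map_zero, eq_comm] at h
  exact (mul_eq_zero.1 h).resolve_right (hself t)

lemma eq_zero_of_forall_apply_mul_eq_zero (hne : ∀ s t, s ≠ t → φ (b s * b' t) = 0)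
    (hself : ∀ s, φ (b s * b' s) ≠ 0) {a : A} (ha : a ∈ Submodule.span k (Set.range b))
    (h : ∀ x, φ (a * x) = 0) : a = 0 := by
  obtain ⟨l, rfl⟩ := Finsupp.mem_span_range_iff_exists_finsupp.1 ha
  suffices l = 0 by rw [this, Finsupp.sum_zero_index]
  ext t
  have ht := h (b' t)
  rw [← Finsupp.linearCombination_apply, apply_linearCombination_mul hne] at ht
  exact (mul_eq_zero.1 ht).resolve_right (hself t)

end Gorenstein

section GradedQuotient

open MvPolynomial Pointwise

variable {σ k : Type*} [Field k] {I : Ideal (MvPolynomial σ k)}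

/-- The class modulo `I` of the monomial with exponent `v`. -/
noncomputable def monomialClass (I : Ideal (MvPolynomial σ k)) (v : σ →₀ ℕ) :
    MvPolynomial σ k ⧸ I :=
  Ideal.Quotient.mk I (monomial v 1)

lemma monomialClass_add (v w : σ →₀ ℕ) :
    monomialClass I (v + w) = monomialClass I v * monomialClass I w := by
  rw [monomialClass, ← one_mul (1 : k), ← monomial_mul, map_mul]
  rfl

lemma monomialClass_mem_quotientComponent (v : σ →₀ ℕ) :
    monomialClass I v ∈ quotientComponent I v.degree :=
  ⟨monomial v 1, isHomogeneous_monomial _ rfl, rfl⟩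

lemma monomialClass_single_mem_quotientComponent (i : σ) :
    monomialClass I (Finsupp.single i 1) ∈ quotientComponent I 1 := by
  simpa only [Finsupp.degree_single] using monomialClass_mem_quotientComponent (Finsupp.single i 1)

lemma quotientComponent_eq_span (i : ℕ) :
    quotientComponent I i = Submodule.span k (monomialClass I '' {v | v.degree = i}) := by
  rw [quotientComponent, homogeneousSubmodule_eq_finsupp_supported,
    AddMonoidAlgebra.supported_eq_span_single, Submodule.map_span, Set.image_image]
  rfl

lemma span_range_monomialClass : Submodule.span k (Set.range (monomialClass I)) = ⊤ := by
  have h := congrArg (Submodule.map (Ideal.Quotient.mkₐ k I).toLinearMap)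
    (basisMonomials σ k).span_eq
  rw [Submodule.map_span, ← Set.range_comp, Submodule.map_top,
    LinearMap.range_eq_top.2 (Ideal.Quotient.mkₐ_surjective k I), coe_basisMonomials] at h
  exact h

section SpanningFamily

variable {ι : Type*} {e : ι → σ →₀ ℕ}
  (h : ∀ v, monomialClass I v ∈
    Submodule.span k ((fun s => monomialClass I (e s)) '' {s | (e s).degree = v.degree}))
include h

lemma quotientComponent_eq_span_of_family (i : ℕ) :
    quotientComponent I i =
      Submodule.span k ((fun s => monomialClass I (e s)) '' {s | (e s).degree = i}) := by
  rw [quotientComponent_eq_span]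
  refine le_antisymm (Submodule.span_le.2 ?_) (Submodule.span_mono ?_)
  · rintro _ ⟨v, rfl, rfl⟩
    exact h v
  · rintro _ ⟨s, hs, rfl⟩
    exact ⟨e s, hs, rfl⟩

lemma span_range_of_family : Submodule.span k (Set.range fun s => monomialClass I (e s)) = ⊤ := by
  rw [← top_le_iff, ← span_range_monomialClass, Submodule.span_le]
  rintro _ ⟨v, rfl⟩
  exact Submodule.span_mono (Set.image_subset_range _ _) (h v)

end SpanningFamily

lemma exists_functional_quotient_span {G : Set (MvPolynomial σ k)}
    {φ : MvPolynomial σ k →ₗ[k] k} (h : ∀ g ∈ G, ∀ v, φ (monomial v 1 * g) = 0) :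
    ∃ ψ : MvPolynomial σ k ⧸ Ideal.span G →ₗ[k] k,
      ∀ v, ψ (monomialClass (Ideal.span G) v) = φ (monomial v 1) := by
  have hker : (Ideal.span G).restrictScalars k ≤ LinearMap.ker φ := by
    rw [Ideal.span, ← Submodule.span_smul_of_span_eq_top (basisMonomials σ k).span_eq,
      Submodule.span_le]
    rintro _ ⟨_, ⟨v, rfl⟩, g, hg, rfl⟩
    rw [coe_basisMonomials]
    exact h g hg v
  exact ⟨((Ideal.span G).restrictScalars k).liftQ φ hker ∘ₗ
    (Submodule.Quotient.restrictScalarsEquiv k (Ideal.span G)).symm.toLinearMap, fun v => rfl⟩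

lemma mul_mem_quotientComponent {i j : ℕ} {a b : MvPolynomial σ k ⧸ I}
    (ha : a ∈ quotientComponent I i) (hb : b ∈ quotientComponent I j) :
    a * b ∈ quotientComponent I (i + j) := by
  obtain ⟨f, hf, rfl⟩ := ha
  obtain ⟨g, hg, rfl⟩ := hb
  exact ⟨f * g, IsHomogeneous.mul hf hg, map_mul (Ideal.Quotient.mkₐ k I) f g⟩

lemma pow_mul_mem_quotientComponent {i : ℕ} {l a : MvPolynomial σ k ⧸ I}
    (hl : l ∈ quotientComponent I 1) (ha : a ∈ quotientComponent I i) (e : ℕ) :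
    l ^ e * a ∈ quotientComponent I (i + e) := by
  induction e with
  | zero => simpa using ha
  | succ e ih =>
    rw [pow_succ', mul_assoc, ← add_assoc, add_comm _ 1]
    exact mul_mem_quotientComponent hl ih

variable [FiniteDimensional k (MvPolynomial σ k ⧸ I)] {D : ℕ} {l : MvPolynomial σ k ⧸ I}

lemma surjOn_pow_mul_of_disjoint_ker (hl : l ∈ quotientComponent I 1) {i j e : ℕ} (hj : i + e = j)
    (hrank : Module.finrank k (quotientComponent I j) ≤ Module.finrank k (quotientComponent I i))
    (hinj : Disjoint (quotientComponent I i) (LinearMap.ker (LinearMap.mulLeft k (l ^ e)))) :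
    Set.SurjOn (fun a => l ^ e * a) (quotientComponent I i) (quotientComponent I j) := by
  subst hj
  have hle : (quotientComponent I i).map (LinearMap.mulLeft k (l ^ e)) ≤
      quotientComponent I (i + e) := by
    rintro _ ⟨a, ha, rfl⟩
    exact pow_mul_mem_quotientComponent hl ha e
  have hmap : Module.finrank k ((quotientComponent I i).map (LinearMap.mulLeft k (l ^ e))) =
      Module.finrank k (quotientComponent I i) := by
    rw [← LinearMap.range_domRestrict]
    exact LinearMap.finrank_range_of_inj (LinearMap.injective_domRestrict_iff.2 hinj)
  exact (Submodule.eq_of_le_of_finrank_le hle (hmap.symm ▸ hrank)).ge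

theorem HasSLP.of_finrank_le_of_disjoint_ker
    (hI : I.IsHomogeneous (homogeneousSubmodule σ k))
    (hbot : ∀ i, D < i → quotientComponent I i = ⊥)
    (hrank : ∀ i, 2 * i ≤ D → Module.finrank k (quotientComponent I (D - i)) ≤
      Module.finrank k (quotientComponent I i))
    (hl : l ∈ quotientComponent I 1)
    (hinj : ∀ i, 2 * i ≤ D → Disjoint (quotientComponent I i)
      (LinearMap.ker (LinearMap.mulLeft k (l ^ (D - 2 * i))))) : HasSLP I := by
  refine ⟨hI, IsArtinianRing.of_finite k _, l, hl, fun e i => ?_⟩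
  rcases le_or_gt (2 * i + e) D with hle | hlt
  · left
    refine LinearMap.disjoint_ker_iff_injOn (f := LinearMap.mulLeft k (l ^ e)) |>.1 ?_
    refine (hinj i (by lia)).mono_right fun a ha => ?_
    rw [LinearMap.mem_ker, LinearMap.mulLeft_apply] at ha ⊢
    rw [show D - 2 * i = D - 2 * i - e + e by lia, pow_add, mul_assoc, ha, mul_zero]
  · right
    rcases lt_or_ge D (i + e) with hD | hD
    · intro y hy
      rw [SetLike.mem_coe, hbot _ hD, Submodule.mem_bot] at hy
      exact ⟨0, zero_mem _, by simp [hy]⟩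
    · -- the map out of degree `D - (i + e) ≤ i` onto degree `i + e` factors through degree `i`
      obtain ⟨j, hj⟩ : ∃ j, i + e = D - j ∧ j ≤ i ∧ 2 * j ≤ D := ⟨D - (i + e), by lia⟩
      intro y hy
      obtain ⟨x, hx, rfl⟩ := surjOn_pow_mul_of_disjoint_ker hl (by lia)
        (hrank j hj.2.2) (hinj j hj.2.2) (hj.1 ▸ hy)
      refine ⟨l ^ (i - j) * x, ?_, ?_⟩
      · have := pow_mul_mem_quotientComponent hl hx (i - j)
        rwa [Nat.add_sub_cancel' hj.2.1] at this
      · dsimp only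
        rw [← mul_assoc, ← pow_add, show e + (i - j) = D - 2 * j by lia]

end GradedQuotient

section Box

open Finsupp

/-- The lattice points of a disjoint union of boxes, the one labelled `q` having side lengths
`sz q i`. A point is recorded by its label and by its position relative to the corner of its box,
as a finitely supported function so that it can serve as the exponent of a monomial. -/
@[ext]
structure BoxIndex {Q σ : Type*} (sz : Q → σ → ℕ) where
  box : Q
  exp : σ →₀ ℕ
  exp_lt : ∀ i, exp i < sz box i

namespace BoxIndex

variable {Q σ : Type*} {sz : Q → σ → ℕ}

instance [Finite Q] [Finite σ] : Finite (BoxIndex sz) := by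
  refine Finite.of_injective
    (fun s : BoxIndex sz => (⟨s.box, fun i => ⟨s.exp i, s.exp_lt i⟩⟩ : Σ q, ∀ i, Fin (sz q i))) ?_
  rintro ⟨q, u, hu⟩ ⟨q', u', hu'⟩ h
  obtain ⟨rfl, h⟩ := Sigma.mk.inj_iff.1 h
  exact BoxIndex.ext rfl (Finsupp.ext fun i => congrArg Fin.val (congrFun (eq_of_heq h) i))

/-- The reflection of each box in its centre. -/
noncomputable def rev [Finite σ] (s : BoxIndex sz) : BoxIndex sz where
  box := s.box
  exp := equivFunOnFinite.symm fun i => sz s.box i - 1 - s.exp i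
  exp_lt i := by
    have := s.exp_lt i
    simp only [equivFunOnFinite_symm_apply_apply]
    lia

lemma box_rev [Finite σ] (s : BoxIndex sz) : s.rev.box = s.box := rfl

lemma exp_rev_apply [Finite σ] (s : BoxIndex sz) (i : σ) :
    s.rev.exp i = sz s.box i - 1 - s.exp i := rfl

lemma rev_involutive [Finite σ] : Function.Involutive (rev : BoxIndex sz → BoxIndex sz) :=
  fun s => BoxIndex.ext rfl <| Finsupp.ext fun i => by
    have := s.exp_lt i
    rw [exp_rev_apply, exp_rev_apply, box_rev]
    lia

lemma degree_exp_add_degree_exp_rev [Fintype σ] (s : BoxIndex sz) :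
    s.exp.degree + s.rev.exp.degree + Fintype.card σ = ∑ i, sz s.box i := by
  rw [degree_eq_sum, degree_eq_sum, Fintype.card_eq_sum_ones, ← Finset.sum_add_distrib,
    ← Finset.sum_add_distrib]
  refine Finset.sum_congr rfl fun i _ => ?_
  have := s.exp_lt i
  rw [exp_rev_apply]
  lia

end BoxIndex

variable {k : Type*} [CommRing k] {V : Type*} [AddCommGroup V] [Module k V]

lemma finrank_span_image_basis {ι : Type*} [Nontrivial k] (b : Module.Basis ι k V) (P : Set ι) :
    Module.finrank k (Submodule.span k (b '' P)) = Nat.card P := by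
  rw [Set.image_eq_range]
  exact Module.finrank_eq_nat_card_basis
    (Module.Basis.span (b.linearIndependent.comp _ Subtype.val_injective))

variable {Q σ : Type*} {sz : Q → σ → ℕ} (b : Module.Basis (BoxIndex sz) k V)

open Classical in
/-- The basis vector at position `u` of the box `q`, read as zero when `u` is outside the box. -/
noncomputable def boxVec (q : Q) (u : σ →₀ ℕ) : V :=
  if h : ∀ i, u i < sz q i then b ⟨q, u, h⟩ else 0

lemma boxVec_of_forall_lt {q : Q} {u : σ →₀ ℕ} (h : ∀ i, u i < sz q i) :
    boxVec b q u = b ⟨q, u, h⟩ := dif_pos h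

lemma boxVec_box_exp (s : BoxIndex sz) : boxVec b s.box s.exp = b s := dif_pos s.exp_lt

lemma boxVec_of_le {q : Q} {u : σ →₀ ℕ} {i : σ} (h : sz q i ≤ u i) : boxVec b q u = 0 :=
  dif_neg fun hlt => (hlt i).not_ge h

lemma box_eq_and_exp_eq_of_repr_boxVec_ne_zero {q : Q} {u : σ →₀ ℕ} {t : BoxIndex sz}
    (h : b.repr (boxVec b q u) t ≠ 0) : t.box = q ∧ t.exp = u := by
  by_cases hu : ∀ i, u i < sz q i
  · rw [boxVec_of_forall_lt b hu, b.repr_self] at h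
    by_contra hne
    exact h (single_eq_of_ne fun ht => hne (by rw [ht]; exact ⟨rfl, rfl⟩))
  · rw [boxVec, dif_neg hu, map_zero] at h
    exact absurd rfl h

lemma end_ext_boxVec {f g : Module.End k V} (h : ∀ q u, f (boxVec b q u) = g (boxVec b q u)) :
    f = g :=
  b.ext fun s => by rw [← boxVec_box_exp]; exact h _ _

/-- The raising operator of the `sl₂`-triple in the direction `i`: the unit shift. -/
noncomputable def boxRaise (i : σ) : Module.End k V :=
  b.constr k fun s => boxVec b s.box (s.exp + single i 1)

/-- The lowering operator of the `sl₂`-triple in the direction `i`. Its coefficients are those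
making the commutator with the unit shift diagonal, see `lie_boxRaise_boxLower`. -/
noncomputable def boxLower (i : σ) : Module.End k V :=
  b.constr k fun s => ((s.exp i : k) * (sz s.box i - s.exp i)) • boxVec b s.box (s.exp - single i 1)

/-- The weight operator of the `sl₂`-triple in the direction `i`: twice the signed distance from
the centre of the box. -/
noncomputable def boxWeight (i : σ) : Module.End k V :=
  b.constr k fun s => (2 * (s.exp i : k) - sz s.box i + 1) • b s

lemma boxRaise_boxVec (i : σ) (q : Q) (u : σ →₀ ℕ) :
    boxRaise b i (boxVec b q u) = boxVec b q (u + single i 1) := by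
  by_cases h : ∀ i, u i < sz q i
  · rw [boxVec_of_forall_lt b h, boxRaise, Module.Basis.constr_basis]
  · obtain ⟨j, hj⟩ := not_forall.1 h
    rw [not_lt] at hj
    rw [boxVec_of_le b hj, map_zero, boxVec_of_le b (i := j)]
    exact hj.trans (le_self_add (a := u j))

lemma boxLower_boxVec (i : σ) (q : Q) (u : σ →₀ ℕ) :
    boxLower b i (boxVec b q u) =
      ((u i : k) * (sz q i - u i)) • boxVec b q (u - single i 1) := by
  classical
  by_cases h : ∀ i, u i < sz q i
  · rw [boxVec_of_forall_lt b h, boxLower, Module.Basis.constr_basis]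
  · obtain ⟨j, hj⟩ := not_forall.1 h
    rw [not_lt] at hj
    rw [boxVec_of_le b hj, map_zero]
    by_cases hz : sz q j ≤ (u - single i 1 : σ →₀ ℕ) j
    · rw [boxVec_of_le b hz, smul_zero]
    · have hij : i = j ∧ u j = sz q j := by
        rw [tsub_apply, single_apply] at hz
        split_ifs at hz <;> lia
      rw [hij.1, hij.2, sub_self, mul_zero, zero_smul]

lemma boxWeight_boxVec (i : σ) (q : Q) (u : σ →₀ ℕ) :
    boxWeight b i (boxVec b q u) = (2 * (u i : k) - sz q i + 1) • boxVec b q u := by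
  by_cases h : ∀ i, u i < sz q i
  · rw [boxVec_of_forall_lt b h, boxWeight, Module.Basis.constr_basis]
  · rw [boxVec, dif_neg h, map_zero, smul_zero]

lemma exp_eq_of_repr_boxRaise_ne_zero {i : σ} {s t : BoxIndex sz}
    (h : b.repr (boxRaise b i (b s)) t ≠ 0) : t.exp = s.exp + single i 1 := by
  rw [boxRaise, Module.Basis.constr_basis] at h
  exact (box_eq_and_exp_eq_of_repr_boxVec_ne_zero b h).2

attribute [local instance] LieRing.ofAssociativeRing

section Brackets

variable [DecidableEq σ]

lemma lie_boxRaise_boxLower (i j : σ) :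
    ⁅boxRaise b i, boxLower b j⁆ = if i = j then boxWeight b i else 0 := by
  refine end_ext_boxVec b fun q u => ?_
  have hLower : u j ≠ 0 → u - single j 1 + single i 1 = u + single i 1 - single j 1 := fun h =>
    (tsub_add_eq_add_tsub (single_le_iff.2 (Nat.one_le_iff_ne_zero.2 h)))
  rw [Ring.lie_def]
  simp only [LinearMap.sub_apply, Module.End.mul_apply, boxLower_boxVec, boxRaise_boxVec, map_smul]
  split_ifs with hij
  · subst hij
    rw [boxWeight_boxVec, add_tsub_cancel_right]
    by_cases h : u i = 0
    · simp only [h, Nat.cast_zero, zero_mul, zero_smul, zero_sub, ← neg_smul, Finsupp.add_apply,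
        single_eq_same, zero_add, Nat.cast_one, mul_zero]
      congr 1
      ring
    · rw [hLower h, add_tsub_cancel_right, ← sub_smul, Finsupp.add_apply, single_eq_same]
      congr 1
      push_cast
      ring
  · rw [Finsupp.add_apply, single_eq_of_ne' hij, add_zero]
    by_cases h : u j = 0
    · simp only [h, Nat.cast_zero, zero_mul, zero_smul, sub_zero, LinearMap.zero_apply]
    · rw [hLower h, sub_self, LinearMap.zero_apply]

lemma lie_boxWeight_boxRaise (i j : σ) :
    ⁅boxWeight b i, boxRaise b j⁆ = if i = j then 2 • boxRaise b i else 0 := by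
  refine end_ext_boxVec b fun q u => ?_
  rw [Ring.lie_def, LinearMap.sub_apply, Module.End.mul_apply, Module.End.mul_apply,
    boxWeight_boxVec, map_smul, boxRaise_boxVec, boxWeight_boxVec, ← sub_smul, Finsupp.add_apply]
  split_ifs with hij
  · subst hij
    rw [LinearMap.smul_apply, boxRaise_boxVec, ← Nat.cast_smul_eq_nsmul k, single_eq_same]
    congr 1
    push_cast
    ring
  · rw [single_eq_of_ne hij, add_zero, sub_self, zero_smul, LinearMap.zero_apply]

lemma lie_boxWeight_boxLower (i j : σ) :
    ⁅boxWeight b i, boxLower b j⁆ = if i = j then -(2 • boxLower b i) else 0 := by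
  refine end_ext_boxVec b fun q u => ?_
  rw [Ring.lie_def, LinearMap.sub_apply, Module.End.mul_apply, Module.End.mul_apply,
    boxWeight_boxVec, map_smul, boxLower_boxVec, map_smul, boxWeight_boxVec, smul_comm, ← sub_smul,
    tsub_apply]
  split_ifs with hij
  · subst hij
    rw [LinearMap.neg_apply, LinearMap.smul_apply, boxLower_boxVec, ← Nat.cast_smul_eq_nsmul k,
      single_eq_same, ← neg_smul]
    by_cases h : u i = 0
    · simp only [h, Nat.cast_zero, zero_mul, zero_smul, smul_zero]
    · congr 1
      rw [Nat.cast_sub (Nat.one_le_iff_ne_zero.2 h)]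
      push_cast
      ring
  · rw [single_eq_of_ne hij, tsub_zero, sub_self, zero_smul, LinearMap.zero_apply]

end Brackets

variable [Fintype σ]

lemma isSl2Triple_sum_box (h : ∑ i, boxWeight b i ≠ 0) :
    IsSl2Triple (∑ i, boxWeight b i) (∑ i, boxRaise b i) (∑ i, boxLower b i) := by
  classical
  refine ⟨h, ?_, ?_, ?_⟩
  · simp only [sum_lie_sum, lie_boxRaise_boxLower, Finset.sum_ite_eq, Finset.mem_univ, if_true]
  · simp only [sum_lie_sum, lie_boxWeight_boxRaise, Finset.sum_ite_eq, Finset.mem_univ, if_true,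
      Finset.smul_sum]
  · simp only [sum_lie_sum, lie_boxWeight_boxLower, Finset.sum_ite_eq, Finset.mem_univ, if_true,
      Finset.sum_neg_distrib, Finset.smul_sum]

variable {off : Q → ℕ} {D : ℕ} (hD : ∀ q, D + Fintype.card σ = 2 * off q + ∑ i, sz q i)
include hD

lemma sum_boxWeight_apply_of_mem_span {i : ℕ} {v : V}
    (hv : v ∈ Submodule.span k (b '' {s | off s.box + s.exp.degree = i})) :
    (∑ j, boxWeight b j) v = (2 * (i : k) - D) • v := by
  refine LinearMap.eqOn_span (g := (2 * (i : k) - D) • LinearMap.id) ?_ hv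
  rintro _ ⟨s, hs, rfl⟩
  have hDk : ((D + Fintype.card σ : ℕ) : k) = (2 * off s.box + ∑ i, sz s.box i : ℕ) := by
    rw [hD s.box]
  have hik : ((off s.box + s.exp.degree : ℕ) : k) = i := congrArg _ hs
  rw [degree_eq_sum] at hik
  rw [← boxVec_box_exp, LinearMap.smul_apply, LinearMap.id_apply]
  simp only [LinearMap.sum_apply, boxWeight_boxVec, ← Finset.sum_smul]
  congr 1
  push_cast at hDk hik
  simp only [Finset.sum_add_distrib, Finset.sum_sub_distrib, ← Finset.mul_sum, Finset.sum_const,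
    Finset.card_univ, nsmul_eq_mul, mul_one]
  linear_combination 2 * hik + hDk

theorem disjoint_ker_sum_boxRaise_pow [IsDomain k] [CharZero k] [Finite Q] {i : ℕ}
    (hi : 2 * i ≤ D) :
    Disjoint (Submodule.span k (b '' {s | off s.box + s.exp.degree = i}))
      (LinearMap.ker ((∑ j, boxRaise b j) ^ (D - 2 * i))) := by
  have := Module.Finite.of_basis b
  have := Module.Free.of_basis b
  refine LinearMap.disjoint_ker.2 fun v hv hker => ?_
  have hweight : (∑ j, boxWeight b j) v = -((D - 2 * i : ℕ) : k) • v := by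
    rw [sum_boxWeight_apply_of_mem_span b hD hv, Nat.cast_sub hi]
    push_cast
    ring_nf
  by_cases h0 : ∑ j, boxWeight b j = 0
  · rw [h0, LinearMap.zero_apply, eq_comm, neg_smul, neg_eq_zero, smul_eq_zero,
      Nat.cast_eq_zero] at hweight
    refine hweight.elim (fun hDi => ?_) id
    rwa [hDi, pow_zero] at hker
  · exact eq_zero_of_pow_toEnd_e_eq_zero (isSl2Triple_sum_box b h0) hweight
      (by rwa [LieModule.toEnd_module_end])

lemma degree_add_degree_rev (s : BoxIndex sz) :
    off s.box + s.exp.degree + (off s.rev.box + s.rev.exp.degree) = D := by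
  have h := hD s.box
  rw [← s.degree_exp_add_degree_exp_rev] at h
  rw [s.box_rev]
  lia

lemma finrank_span_box_eq_of_add_eq [Nontrivial k] {i j : ℕ} (hij : i + j = D) :
    Module.finrank k (Submodule.span k (b '' {s | off s.box + s.exp.degree = i})) =
      Module.finrank k (Submodule.span k (b '' {s | off s.box + s.exp.degree = j})) := by
  rw [finrank_span_image_basis, finrank_span_image_basis]
  refine Nat.card_congr (BoxIndex.rev_involutive.toPerm.subtypeEquiv fun s => ?_)
  have := degree_add_degree_rev hD s
  simp only [Set.mem_ofPred_eq, Function.Involutive.coe_toPerm]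
  lia

end Box

section BinomialQuotient

open MvPolynomial Finsupp

variable {k : Type u} [Field k] {m : ℕ}

/-- The exponent of the monomial `x_2^{α_2} ⋯ x_n^{α_n}`. -/
noncomputable def tailExp (α : Fin (m + 1) → ℕ) : Fin (m + 1) →₀ ℕ :=
  equivFunOnFinite.symm (Fin.cons 0 fun j => α j.succ)

@[simp] lemma tailExp_zero (α : Fin (m + 1) → ℕ) : tailExp α 0 = 0 := rfl

@[simp] lemma tailExp_succ (α : Fin (m + 1) → ℕ) (j : Fin m) : tailExp α j.succ = α j.succ := rfl

lemma degree_tailExp (α : Fin (m + 1) → ℕ) : (tailExp α).degree = ∑ j : Fin m, α j.succ := by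
  simp [degree_eq_sum, Fin.sum_univ_succ]

lemma prod_X_succ_pow_eq_monomial_tailExp (α : Fin (m + 1) → ℕ) :
    ∏ j : Fin m, (X j.succ : MvPolynomial (Fin (m + 1)) k) ^ α j.succ =
      monomial (tailExp α) 1 := by
  rw [monomial_eq, Finsupp.prod_fintype _ _ fun _ => pow_zero _, Fin.prod_univ_succ]
  simp

/-- The generators of `binomialIdeal d α c`. -/
def binomialGens (d α : Fin (m + 1) → ℕ) (c : k) : Set (MvPolynomial (Fin (m + 1)) k) :=
  {monomial (single 0 (d 0)) 1 + C c * monomial (tailExp α) 1} ∪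
    (Set.range fun j : Fin m => monomial (single j.succ (d j.succ)) 1) ∪
    Set.range fun j : Fin m =>
      monomial (single 0 (d 0 - α 0) + single j.succ (d j.succ - α j.succ)) 1

lemma binomialIdeal_eq_span (d α : Fin (m + 1) → ℕ) (c : k) :
    binomialIdeal d α c = Ideal.span (binomialGens d α c) := by
  rw [binomialIdeal, binomialGens, Ideal.span_union (_ ∪ _), Ideal.span_mul_span',
    Set.singleton_mul, ← Set.range_comp, prod_X_succ_pow_eq_monomial_tailExp]
  simp only [X_pow_eq_monomial, Function.comp_def, monomial_mul, mul_one]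
  rfl

variable {d α : Fin (m + 1) → ℕ} {c : k} {v : Fin (m + 1) →₀ ℕ} {j : Fin m}

lemma binomialIdeal_isHomogeneous (hd : d 0 = ∑ j : Fin m, α j.succ) :
    (binomialIdeal d α c).IsHomogeneous (homogeneousSubmodule (Fin (m + 1)) k) := by
  rw [binomialIdeal_eq_span]
  refine Ideal.homogeneous_span _ _ ?_
  rintro _ ((rfl | ⟨j, rfl⟩) | ⟨j, rfl⟩)
  · have hX : (monomial (single (0 : Fin (m + 1)) (d 0)) (1 : k)).IsHomogeneous (d 0) :=
      isHomogeneous_monomial _ (degree_single _ _)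
    have hT : (C c * monomial (tailExp α) (1 : k)).IsHomogeneous (d 0) :=
      (isHomogeneous_monomial _ ((degree_tailExp α).trans hd.symm)).C_mul c
    exact ⟨d 0, hX.add hT⟩
  · exact ⟨_, isHomogeneous_monomial _ rfl⟩
  · exact ⟨_, isHomogeneous_monomial _ rfl⟩

section Relations

lemma monomialClass_eq_zero_of_le_of_mem {σ : Type*} {I : Ideal (MvPolynomial σ k)} {w v : σ →₀ ℕ}
    (h : w ≤ v) (hw : monomial w 1 ∈ I) : monomialClass I v = 0 := by
  rw [← add_tsub_cancel_of_le h, monomialClass_add, monomialClass,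
    Ideal.Quotient.eq_zero_iff_mem.2 hw, zero_mul]

lemma monomialClass_eq_zero_of_le (h : d j.succ ≤ v j.succ) :
    monomialClass (binomialIdeal d α c) v = 0 := by
  refine monomialClass_eq_zero_of_le_of_mem (single_le_iff.2 h) ?_
  rw [binomialIdeal_eq_span]
  exact Ideal.subset_span (Or.inl (Or.inr ⟨j, rfl⟩))

lemma monomialClass_eq_zero_of_le_of_le (h0 : d 0 - α 0 ≤ v 0)
    (h : d j.succ - α j.succ ≤ v j.succ) : monomialClass (binomialIdeal d α c) v = 0 := by
  have hle : single 0 (d 0 - α 0) + single j.succ (d j.succ - α j.succ) ≤ v := by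
    refine fun i => ?_
    rw [Finsupp.add_apply, single_apply, single_apply]
    have := Fin.succ_ne_zero j
    grind
  refine monomialClass_eq_zero_of_le_of_mem hle ?_
  rw [binomialIdeal_eq_span]
  exact Ideal.subset_span (Or.inr ⟨j, rfl⟩)

lemma monomialClass_add_single_zero (v : Fin (m + 1) →₀ ℕ) :
    monomialClass (binomialIdeal d α c) (v + single 0 (d 0)) =
      (-c) • monomialClass (binomialIdeal d α c) (v + tailExp α) := by
  have h : monomialClass (binomialIdeal d α c) (single 0 (d 0)) =
      (-c) • monomialClass (binomialIdeal d α c) (tailExp α) := by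
    rw [neg_smul, eq_neg_iff_add_eq_zero, monomialClass, monomialClass,
      ← Ideal.Quotient.mkₐ_eq_mk k, ← map_smul, ← map_add, Ideal.Quotient.mkₐ_eq_mk,
      Ideal.Quotient.eq_zero_iff_mem, binomialIdeal_eq_span, smul_eq_C_mul]
    exact Ideal.subset_span (Or.inl (Or.inl rfl))
  rw [monomialClass_add, h, monomialClass_add, mul_smul_comm]

end Relations

section BoxMonomials

/-- The side lengths of the two boxes of exponents of a monomial basis of the quotient. The box
`true` lies above the box `false` in the `x_1`-direction. -/
def boxSize (d α : Fin (m + 1) → ℕ) (q : Bool) : Fin (m + 1) → ℕ :=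
  Fin.cons (cond q (α 0) (d 0 - α 0)) fun j => cond q (d j.succ - α j.succ) (d j.succ)

/-- The `x_1`-coordinate of the corner of each of the two boxes; the other coordinates are `0`. -/
def boxOffset (d α : Fin (m + 1) → ℕ) (q : Bool) : ℕ := cond q (d 0 - α 0) 0

lemma boxSize_zero (q : Bool) : boxSize d α q 0 = cond q (α 0) (d 0 - α 0) := rfl

lemma boxSize_succ (q : Bool) (j : Fin m) :
    boxSize d α q j.succ = cond q (d j.succ - α j.succ) (d j.succ) := rfl

/-- The exponent of the monomial at position `u` relative to the corner of the box `q`. -/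
noncomputable def boxExp (d α : Fin (m + 1) → ℕ) (q : Bool) (u : Fin (m + 1) →₀ ℕ) :
    Fin (m + 1) →₀ ℕ :=
  u + single 0 (boxOffset d α q)

variable {q : Bool} {u : Fin (m + 1) →₀ ℕ}

@[simp] lemma boxExp_zero : boxExp d α q u 0 = u 0 + boxOffset d α q := by simp [boxExp]

@[simp] lemma boxExp_succ : boxExp d α q u j.succ = u j.succ := by simp [boxExp]

lemma degree_boxExp : (boxExp d α q u).degree = boxOffset d α q + u.degree := by
  rw [boxExp, map_add, degree_single, add_comm]

lemma boxExp_add (w : Fin (m + 1) →₀ ℕ) : boxExp d α q (u + w) = boxExp d α q u + w :=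
  add_right_comm _ _ _

lemma boxExp_zero_lt (hα : ∀ i, α i ≤ d i) (hu : u 0 < boxSize d α q 0) :
    boxExp d α q u 0 < d 0 := by
  have := hα 0
  grind [boxExp_zero, boxSize_zero, boxOffset]

lemma eq_true_iff_le_boxExp_zero (hu : u 0 < boxSize d α q 0) :
    q = true ↔ d 0 - α 0 ≤ boxExp d α q u 0 := by
  grind [boxExp_zero, boxSize_zero, boxOffset]

lemma boxIndex_ext_of_boxExp_eq {s t : BoxIndex (boxSize d α)}
    (h : boxExp d α s.box s.exp = boxExp d α t.box t.exp) : s = t := by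
  have hbox : s.box = t.box := by
    rw [Bool.eq_iff_iff, eq_true_iff_le_boxExp_zero (s.exp_lt 0),
      eq_true_iff_le_boxExp_zero (t.exp_lt 0), h]
  refine BoxIndex.ext hbox ?_
  rw [boxExp, boxExp, hbox] at h
  exact add_right_cancel h

lemma exists_boxExp_eq (hα : ∀ i, α i ≤ d i) (hv : v 0 < d 0) :
    ∃ q u, u 0 < boxSize d α q 0 ∧ boxExp d α q u = v := by
  by_cases h0 : v 0 < d 0 - α 0
  · exact ⟨false, v, h0, by rw [boxExp, boxOffset, cond_false, single_zero, add_zero]⟩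
  · refine ⟨true, v - single 0 (d 0 - α 0), ?_, tsub_add_cancel_of_le ?_⟩
    · have := hα 0
      rw [tsub_apply, single_eq_same, boxSize_zero, cond_true]
      lia
    · exact single_le_iff.2 (not_lt.1 h0)

lemma monomialClass_boxExp_eq_zero (h : boxSize d α q j.succ ≤ u j.succ) :
    monomialClass (binomialIdeal d α c) (boxExp d α q u) = 0 := by
  rw [← boxExp_succ (d := d) (α := α) (q := q)] at h
  cases q
  · exact monomialClass_eq_zero_of_le h
  · exact monomialClass_eq_zero_of_le_of_le (by rw [boxExp_zero]; exact le_add_self) h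

-- Replacing `x_1^{d_1}` by a multiple of `x_2^{α_2} ⋯ x_n^{α_n}` lowers the `x_1`-exponent.
lemma monomialClass_mem_span_boxExp (hα : ∀ i, α i ≤ d i) (hd : d 0 = ∑ j : Fin m, α j.succ)
    (hd0 : 0 < d 0) (v : Fin (m + 1) →₀ ℕ) :
    monomialClass (binomialIdeal d α c) v ∈ Submodule.span k
      ((fun s : BoxIndex (boxSize d α) =>
          monomialClass (binomialIdeal d α c) (boxExp d α s.box s.exp)) ''
        {s | (boxExp d α s.box s.exp).degree = v.degree}) := by
  induction hn : v 0 using Nat.strong_induction_on generalizing v with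
  | _ n ih =>
    rcases lt_or_ge (v 0) (d 0) with hv | hv
    · obtain ⟨q, u, hu0, rfl⟩ := exists_boxExp_eq hα hv
      by_cases hu : ∀ j : Fin m, u j.succ < boxSize d α q j.succ
      · exact Submodule.subset_span ⟨⟨q, u, Fin.cases hu0 hu⟩, rfl, rfl⟩
      · obtain ⟨j, hj⟩ := not_forall.1 hu
        rw [monomialClass_boxExp_eq_zero (not_lt.1 hj)]
        exact zero_mem _
    · obtain ⟨w, rfl⟩ : ∃ w, v = w + single 0 (d 0) :=
        ⟨v - single 0 (d 0), (tsub_add_cancel_of_le (single_le_iff.2 hv)).symm⟩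
      have hlt : (w + tailExp α) 0 < n := by
        rw [← hn, Finsupp.add_apply, Finsupp.add_apply, tailExp_zero, single_eq_same]
        lia
      have hdeg : (w + tailExp α).degree = (w + single 0 (d 0)).degree := by
        rw [map_add, map_add, degree_tailExp, degree_single, hd]
      rw [monomialClass_add_single_zero, ← hdeg]
      exact Submodule.smul_mem _ _ (ih _ hlt _ rfl)

end BoxMonomials

section SocleFunctional

/-- The coefficient of the monomial with exponent `v` in the functional on the polynomial ring that
spans the inverse system of `binomialIdeal d α c`. -/
def socleCoeff (d α : Fin (m + 1) → ℕ) (c : k) (v : Fin (m + 1) →₀ ℕ) : k :=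
  let N := (v 0 + α 0 + 1) / d 0
  if v 0 + α 0 + 1 = N * d 0 ∧ ∀ j : Fin m, v j.succ + N * α j.succ + 1 = d j.succ + α j.succ
  then (-c) ^ N else 0

lemma socleCoeff_eq_pow (hd0 : 0 < d 0) {N : ℕ} (h0 : v 0 + α 0 + 1 = N * d 0)
    (h : ∀ j : Fin m, v j.succ + N * α j.succ + 1 = d j.succ + α j.succ) :
    socleCoeff d α c v = (-c) ^ N := by
  have hN : (v 0 + α 0 + 1) / d 0 = N := by rw [h0, Nat.mul_div_cancel _ hd0]
  simp only [socleCoeff, hN]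
  exact if_pos ⟨h0, h⟩

lemma exists_of_socleCoeff_ne_zero (h : socleCoeff d α c v ≠ 0) :
    ∃ N, v 0 + α 0 + 1 = N * d 0 ∧
      ∀ j : Fin m, v j.succ + N * α j.succ + 1 = d j.succ + α j.succ :=
  ⟨_, (ite_ne_right_iff.1 h).1⟩

lemma socleCoeff_eq_zero_of_le (h : d j.succ ≤ v j.succ) : socleCoeff d α c v = 0 := by
  by_contra hne
  obtain ⟨N, h0, hN⟩ := exists_of_socleCoeff_ne_zero hne
  have := hN j
  rcases N with _ | N
  · lia
  · rw [add_mul, one_mul] at this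
    lia

lemma socleCoeff_eq_zero_of_le_of_le (h0 : d 0 - α 0 ≤ v 0)
    (h : d j.succ - α j.succ ≤ v j.succ) : socleCoeff d α c v = 0 := by
  by_contra hne
  obtain ⟨N, h0N, hN⟩ := exists_of_socleCoeff_ne_zero hne
  have := hN j
  rcases N with _ | _ | N
  · lia
  · lia
  · rw [add_mul, add_mul, one_mul] at this
    lia

lemma socleCoeff_add_single (hd0 : 0 < d 0) (v : Fin (m + 1) →₀ ℕ) :
    socleCoeff d α c (v + single 0 (d 0)) = -c * socleCoeff d α c (v + tailExp α) := by
  have hN : (v 0 + d 0 + α 0 + 1) / d 0 = (v 0 + α 0 + 1) / d 0 + 1 := by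
    rw [← Nat.add_div_right _ hd0]
    congr 1
    ring
  simp only [socleCoeff, Finsupp.add_apply, single_eq_same, tailExp_zero, tailExp_succ, add_zero,
    single_eq_of_ne (Fin.succ_ne_zero _), hN, mul_ite, mul_zero, ← pow_succ']
  refine if_congr (and_congr ?_ (forall_congr' fun j => ?_)) rfl rfl
  · rw [add_mul, one_mul]
    lia
  · rw [add_mul, one_mul]
    lia

lemma exists_functional_binomialIdeal (α : Fin (m + 1) → ℕ) (c : k) (hd0 : 0 < d 0) :
    ∃ φ : MvPolynomial (Fin (m + 1)) k ⧸ binomialIdeal d α c →ₗ[k] k,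
      ∀ v, φ (monomialClass (binomialIdeal d α c) v) = socleCoeff d α c v := by
  let φ := (basisMonomials (Fin (m + 1)) k).constr k (socleCoeff d α c)
  have hφ : ∀ v, φ (monomial v 1) = socleCoeff d α c v := fun v => by
    rw [← congrFun (coe_basisMonomials (Fin (m + 1)) k) v]
    exact Module.Basis.constr_basis _ _ _ _
  rw [binomialIdeal_eq_span]
  simp only [← hφ]
  refine exists_functional_quotient_span ?_
  rintro _ ((rfl | ⟨j, rfl⟩) | ⟨j, rfl⟩) v
  · rw [← smul_eq_C_mul, mul_add, mul_smul_comm, monomial_mul, monomial_mul, mul_one, map_add,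
      map_smul, hφ, hφ, socleCoeff_add_single hd0, smul_eq_mul]
    ring
  · rw [monomial_mul, mul_one, hφ]
    exact socleCoeff_eq_zero_of_le (j := j) (by simp)
  · rw [monomial_mul, mul_one, hφ]
    exact socleCoeff_eq_zero_of_le_of_le (j := j) (by simp) (by simp)

lemma boxExp_zero_add_boxExp_rev_zero (hα : ∀ i, α i ≤ d i) (s : BoxIndex (boxSize d α)) :
    boxExp d α s.box s.exp 0 + boxExp d α s.rev.box s.rev.exp 0 + α 0 + 1 =
      (s.box.toNat + 1) * d 0 := by
  have := hα 0
  have := s.exp_lt 0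
  rw [boxExp_zero, boxExp_zero, s.box_rev, s.exp_rev_apply]
  cases h : s.box <;> grind [boxSize_zero, boxOffset]

lemma boxExp_succ_add_boxExp_rev_succ (hα : ∀ i, α i ≤ d i) (s : BoxIndex (boxSize d α))
    (j : Fin m) :
    boxExp d α s.box s.exp j.succ + boxExp d α s.rev.box s.rev.exp j.succ +
      (s.box.toNat + 1) * α j.succ + 1 = d j.succ + α j.succ := by
  have := hα j.succ
  have := s.exp_lt j.succ
  rw [boxExp_succ, boxExp_succ, s.exp_rev_apply]
  cases h : s.box <;> grind [boxSize_succ]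

lemma socleCoeff_boxExp_add_boxExp_rev_self (hα : ∀ i, α i ≤ d i) (hd0 : 0 < d 0)
    (s : BoxIndex (boxSize d α)) :
    socleCoeff d α c (boxExp d α s.box s.exp + boxExp d α s.rev.box s.rev.exp) =
      (-c) ^ (s.box.toNat + 1) :=
  socleCoeff_eq_pow hd0 (boxExp_zero_add_boxExp_rev_zero hα s)
    (boxExp_succ_add_boxExp_rev_succ hα s)

lemma socleCoeff_boxExp_add_boxExp_rev_of_ne (hα : ∀ i, α i ≤ d i)
    {s t : BoxIndex (boxSize d α)} (hst : s ≠ t) :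
    socleCoeff d α c (boxExp d α s.box s.exp + boxExp d α t.rev.box t.rev.exp) = 0 := by
  by_contra hne
  obtain ⟨N, h0, h⟩ := exists_of_socleCoeff_ne_zero hne
  simp only [Finsupp.add_apply] at h0 h
  have ht0 := boxExp_zero_add_boxExp_rev_zero hα t
  have hs : boxExp d α s.box s.exp 0 < d 0 := boxExp_zero_lt hα (s.exp_lt 0)
  have ht : boxExp d α t.box t.exp 0 < d 0 := boxExp_zero_lt hα (t.exp_lt 0)
  have hshift : boxExp d α s.box s.exp 0 + (t.box.toNat + 1) * d 0 =
      boxExp d α t.box t.exp 0 + N * d 0 := by lia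
  obtain rfl : t.box.toNat + 1 = N := by
    have := congrArg (· / d 0) hshift
    simpa only [Nat.add_mul_div_right _ _ (pos_of_gt hs), Nat.div_eq_of_lt, hs, ht, zero_add]
      using this
  refine hst (boxIndex_ext_of_boxExp_eq (Finsupp.ext (Fin.cases (by lia) fun j => ?_)))
  have := h j
  have := boxExp_succ_add_boxExp_rev_succ hα t j
  lia

lemma exists_functional_dual_boxExp (hα : ∀ i, α i ≤ d i) (hd0 : 0 < d 0) (hc : c ≠ 0) :
    ∃ φ : MvPolynomial (Fin (m + 1)) k ⧸ binomialIdeal d α c →ₗ[k] k,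
      (∀ s t : BoxIndex (boxSize d α), s ≠ t →
        φ (monomialClass _ (boxExp d α s.box s.exp) *
          monomialClass _ (boxExp d α t.rev.box t.rev.exp)) = 0) ∧
      ∀ s : BoxIndex (boxSize d α),
        φ (monomialClass _ (boxExp d α s.box s.exp) *
          monomialClass _ (boxExp d α s.rev.box s.rev.exp)) ≠ 0 := by
  obtain ⟨φ, hφ⟩ := exists_functional_binomialIdeal α c hd0
  refine ⟨φ, fun s t hst => ?_, fun s => ?_⟩
  · rw [← monomialClass_add, hφ, socleCoeff_boxExp_add_boxExp_rev_of_ne hα hst]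
  · rw [← monomialClass_add, hφ, socleCoeff_boxExp_add_boxExp_rev_self hα hd0]
    exact pow_ne_zero _ (neg_ne_zero.2 hc)

end SocleFunctional

section Basis

variable (hα : ∀ i, α i ≤ d i) (hd : d 0 = ∑ j : Fin m, α j.succ) (hd0 : 0 < d 0) (hc : c ≠ 0)

/-- The basis of the quotient by `binomialIdeal d α c` formed by the monomials whose exponents lie
in one of the two boxes. -/
noncomputable def monomialBasis : Module.Basis (BoxIndex (boxSize d α)) k
    (MvPolynomial (Fin (m + 1)) k ⧸ binomialIdeal d α c) :=
  .mk (v := fun s => monomialClass _ (boxExp d α s.box s.exp))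
    (by
      obtain ⟨φ, hne, hself⟩ := exists_functional_dual_boxExp hα hd0 hc
      exact linearIndependent_of_dual_family hne hself)
    (span_range_of_family (monomialClass_mem_span_boxExp hα hd hd0)).ge

lemma monomialBasis_apply (s : BoxIndex (boxSize d α)) :
    monomialBasis hα hd hd0 hc s = monomialClass _ (boxExp d α s.box s.exp) :=
  Module.Basis.mk_apply _ _ _

lemma quotientComponent_eq_span_monomialBasis (i : ℕ) :
    quotientComponent (binomialIdeal d α c) i = Submodule.span k
      (monomialBasis hα hd hd0 hc '' {s | boxOffset d α s.box + s.exp.degree = i}) := by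
  rw [quotientComponent_eq_span_of_family (monomialClass_mem_span_boxExp hα hd hd0)]
  simp only [degree_boxExp, ← monomialBasis_apply hα hd hd0 hc]

lemma monomialClass_boxExp_eq_boxVec {q : Bool} {u : Fin (m + 1) →₀ ℕ}
    (hu : u 0 < boxSize d α q 0) :
    monomialClass _ (boxExp d α q u) = boxVec (monomialBasis hα hd hd0 hc) q u := by
  by_cases h : ∀ j : Fin m, u j.succ < boxSize d α q j.succ
  · rw [boxVec_of_forall_lt _ (Fin.cases hu h), monomialBasis_apply]
  · obtain ⟨j, hj⟩ := not_forall.1 h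
    rw [boxVec_of_le _ (not_lt.1 hj), monomialClass_boxExp_eq_zero (not_lt.1 hj)]

lemma mul_monomialBasis (i : Fin (m + 1)) (s : BoxIndex (boxSize d α)) :
    monomialClass _ (single i 1) * monomialBasis hα hd hd0 hc s =
      monomialClass _ (boxExp d α s.box (s.exp + single i 1)) := by
  rw [monomialBasis_apply, mul_comm, boxExp_add, monomialClass_add]

theorem mulLeft_single_succ_eq_boxRaise (j : Fin m) :
    LinearMap.mulLeft k (monomialClass (binomialIdeal d α c) (single j.succ 1)) =
      boxRaise (monomialBasis hα hd hd0 hc) j.succ := by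
  refine (monomialBasis hα hd hd0 hc).ext fun s => ?_
  rw [LinearMap.mulLeft_apply, mul_monomialBasis, monomialClass_boxExp_eq_boxVec hα hd hd0 hc,
    boxRaise, Module.Basis.constr_basis]
  simpa using s.exp_lt 0

lemma exp_zero_eq_zero_of_boxExp_zero_eq {q : Bool} {u : Fin (m + 1) →₀ ℕ}
    (hu : u 0 < boxSize d α q 0) (h : boxExp d α q u 0 = 0 ∨ boxExp d α q u 0 = d 0 - α 0) :
    u 0 = 0 := by
  grind [boxExp_zero, boxSize_zero, boxOffset]

include hα hd0 in
lemma exists_monomialClass_boxExp_eq_smul {s : BoxIndex (boxSize d α)}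
    (hs : s.exp 0 + 1 = boxSize d α s.box 0) :
    ∃ (a : k) (q : Bool) (u : Fin (m + 1) →₀ ℕ), u 0 = 0 ∧ u 0 < boxSize d α q 0 ∧
      monomialClass (binomialIdeal d α c) (boxExp d α s.box (s.exp + single 0 1)) =
        a • monomialClass _ (boxExp d α q u) := by
  have hw : boxExp d α s.box (s.exp + single 0 1) 0 =
      boxSize d α s.box 0 + boxOffset d α s.box := by
    rw [boxExp_zero, ← hs, Finsupp.add_apply, single_eq_same]
  generalize boxExp d α s.box (s.exp + single 0 1) = w at hw ⊢
  have hw' : w 0 = d 0 - α 0 ∨ w 0 = d 0 := by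
    have := hα 0
    grind [boxSize_zero, boxOffset]
  rcases (show w 0 ≤ d 0 by lia).lt_or_eq with hlt | heq
  · obtain ⟨q, u, hu, rfl⟩ := exists_boxExp_eq hα hlt
    exact ⟨1, q, u, exp_zero_eq_zero_of_boxExp_zero_eq hu (.inr (hw'.resolve_right hlt.ne)), hu,
      (one_smul k _).symm⟩
  · obtain ⟨w, rfl⟩ : ∃ w', w = w' + single 0 (d 0) :=
      ⟨w - single 0 (d 0), (tsub_add_cancel_of_le (single_le_iff.2 heq.ge)).symm⟩
    have h0 : (w + tailExp α) 0 = 0 := by simpa using heq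
    obtain ⟨q, u, hu, hqu⟩ := exists_boxExp_eq hα (h0.trans_lt hd0)
    refine ⟨-c, q, u, exp_zero_eq_zero_of_boxExp_zero_eq hu (.inl (by rw [hqu, h0])), hu, ?_⟩
    rw [monomialClass_add_single_zero, hqu]

theorem exp_zero_eq_zero_of_repr_mulLeft_sub_boxRaise_ne_zero {s t : BoxIndex (boxSize d α)}
    (h : (monomialBasis hα hd hd0 hc).repr
      ((LinearMap.mulLeft k (monomialClass (binomialIdeal d α c) (single 0 1)) -
        boxRaise (monomialBasis hα hd hd0 hc) 0) (monomialBasis hα hd hd0 hc s)) t ≠ 0) :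
    t.exp 0 = 0 := by
  rw [LinearMap.sub_apply, LinearMap.mulLeft_apply, mul_monomialBasis, boxRaise,
    Module.Basis.constr_basis] at h
  rcases (Nat.succ_le_of_lt (s.exp_lt 0)).lt_or_eq with hs | hs
  · rw [monomialClass_boxExp_eq_boxVec hα hd hd0 hc (by simpa using hs), sub_self, map_zero] at h
    exact absurd rfl h
  · obtain ⟨a, q, u, hu0, hu, hau⟩ := exists_monomialClass_boxExp_eq_smul (c := c) hα hd0 hs
    rw [boxVec_of_le (i := 0) _ (by simpa using hs.ge), sub_zero, hau,
      monomialClass_boxExp_eq_boxVec hα hd hd0 hc hu, map_smul, Finsupp.smul_apply] at h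
    rw [(box_eq_and_exp_eq_of_repr_boxVec_ne_zero _ (right_ne_zero_of_smul h)).2, hu0]

end Basis

end BinomialQuotient

section Lefschetz

open MvPolynomial Finsupp

variable {k : Type u} [Field k] {m : ℕ} {d α : Fin (m + 1) → ℕ} {c : k}

section Nondegenerate

variable (hα : ∀ i, α i ≤ d i) (hd : d 0 = ∑ j : Fin m, α j.succ)

include hα hd in
/-- That the left side does not depend on `q` means that the centres of the two boxes have the same
degree. -/
lemma two_mul_boxOffset_add_sum_boxSize (q : Bool) :
    2 * boxOffset d α q + ∑ i, boxSize d α q i = d 0 - α 0 + ∑ j : Fin m, d j.succ := by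
  have htail : ∑ j : Fin m, (d j.succ - α j.succ) + d 0 = ∑ j : Fin m, d j.succ := by
    rw [hd, ← Finset.sum_add_distrib]
    exact Finset.sum_congr rfl fun j _ => Nat.sub_add_cancel (hα _)
  have := hα 0
  rw [Fin.sum_univ_succ]
  cases q <;> simp only [boxSize_zero, boxSize_succ, boxOffset, cond_true, cond_false] <;> lia

variable (hd0 : 0 < d 0) (hc : c ≠ 0)
include hα hd hd0 hc

lemma exists_socleDegree (hK : binomialIdeal d α c ≠ ⊤) :
    ∃ D, ∀ q, D + Fintype.card (Fin (m + 1)) = 2 * boxOffset d α q + ∑ i, boxSize d α q i := by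
  have := Ideal.Quotient.nontrivial_iff.2 hK
  obtain ⟨s⟩ := (monomialBasis hα hd hd0 hc).index_nonempty
  refine ⟨2 * boxOffset d α s.box + s.exp.degree + s.rev.exp.degree, fun q => ?_⟩
  rw [two_mul_boxOffset_add_sum_boxSize hα hd, ← two_mul_boxOffset_add_sum_boxSize hα hd s.box,
    ← s.degree_exp_add_degree_exp_rev]
  ring

theorem isGorensteinRing_quotient_binomialIdeal :
    IsGorensteinRing (MvPolynomial (Fin (m + 1)) k ⧸ binomialIdeal d α c) := by
  have := Module.Finite.of_basis (monomialBasis hα hd hd0 hc)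
  obtain ⟨φ, hne, hself⟩ := exists_functional_dual_boxExp hα hd0 hc
  refine isGorensteinRing_of_nondegenerate (φ := φ) fun a ha =>
    eq_zero_of_forall_apply_mul_eq_zero hne hself ?_ ha
  rw [span_range_of_family (monomialClass_mem_span_boxExp hα hd hd0)]
  exact Submodule.mem_top

lemma mulLeft_sum_add_smul (μ : k) :
    LinearMap.mulLeft k (∑ j : Fin m, monomialClass (binomialIdeal d α c) (single j.succ 1) +
        μ • monomialClass (binomialIdeal d α c) (single 0 1)) =
      ∑ j : Fin m, boxRaise (monomialBasis hα hd hd0 hc) j.succ +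
        μ • (boxRaise (monomialBasis hα hd hd0 hc) 0 +
          (LinearMap.mulLeft k (monomialClass (binomialIdeal d α c) (single 0 1)) -
            boxRaise (monomialBasis hα hd hd0 hc) 0)) := by
  simp only [add_sub_cancel, ← mulLeft_single_succ_eq_boxRaise]
  refine LinearMap.ext fun a => ?_
  simp only [LinearMap.mulLeft_apply, LinearMap.add_apply, LinearMap.sum_apply,
    LinearMap.smul_apply, add_mul, Finset.sum_mul, smul_mul_assoc]

variable [CharZero k] {D : ℕ}
  (hD : ∀ q, D + Fintype.card (Fin (m + 1)) = 2 * boxOffset d α q + ∑ i, boxSize d α q i)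
include hD

theorem exists_linearForm_disjoint_ker :
    ∃ l ∈ quotientComponent (binomialIdeal d α c) 1, ∀ i, 2 * i ≤ D →
      Disjoint (quotientComponent (binomialIdeal d α c) i)
        (LinearMap.ker (LinearMap.mulLeft k (l ^ (D - 2 * i)))) := by
  let b := monomialBasis hα hd hd0 hc
  let x (i : Fin (m + 1)) := monomialClass (binomialIdeal d α c) (single i 1)
  have hx : ∀ i, x i ∈ quotientComponent (binomialIdeal d α c) 1 :=
    monomialClass_single_mem_quotientComponent
  obtain ⟨μ, -, hμ⟩ := exists_disjoint_ker_pow_of_weight b (fun s => s.exp 0)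
    (Y := ∑ j : Fin m, boxRaise b j.succ) (R := boxRaise b 0)
    (Z := LinearMap.mulLeft k (x 0) - boxRaise b 0)
    (fun s t h => by
      rw [LinearMap.sum_apply, map_sum, Finsupp.finsetSum_apply] at h
      obtain ⟨j, -, hj⟩ := Finset.exists_ne_zero_of_sum_ne_zero h
      simp [exp_eq_of_repr_boxRaise_ne_zero b hj])
    (fun s t h => by simp [exp_eq_of_repr_boxRaise_ne_zero b h])
    (fun s t h => by
      rw [exp_zero_eq_zero_of_repr_mulLeft_sub_boxRaise_ne_zero hα hd hd0 hc h]
      exact Nat.zero_le _)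
    (Finset.range (D / 2 + 1)) (fun i => D - 2 * i)
    (fun i => {s | boxOffset d α s.box + s.exp.degree = i})
    (fun i hi => by
      rw [add_comm (∑ j : Fin m, _), ← Fin.sum_univ_succ]
      exact disjoint_ker_sum_boxRaise_pow b hD (by rw [Finset.mem_range] at hi; lia))
  refine ⟨∑ j : Fin m, x j.succ + μ • x 0, add_mem (sum_mem fun j _ => hx _)
    (Submodule.smul_mem _ _ (hx 0)), fun i hi => ?_⟩
  rw [← LinearMap.pow_mulLeft, mulLeft_sum_add_smul hα hd hd0 hc,
    quotientComponent_eq_span_monomialBasis hα hd hd0 hc]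
  exact hμ i (Finset.mem_range.2 (by lia))

omit hD in
theorem hasSLP_binomialIdeal (hK : binomialIdeal d α c ≠ ⊤) : HasSLP (binomialIdeal d α c) := by
  have := Module.Finite.of_basis (monomialBasis hα hd hd0 hc)
  obtain ⟨D, hD⟩ := exists_socleDegree hα hd hd0 hc hK
  obtain ⟨l, hl, hinj⟩ := exists_linearForm_disjoint_ker hα hd hd0 hc hD
  refine HasSLP.of_finrank_le_of_disjoint_ker (D := D) (binomialIdeal_isHomogeneous hd)
    (fun i hi => ?_) (fun i hi => ?_) hl hinj
  · rw [quotientComponent_eq_span_monomialBasis hα hd hd0 hc, Submodule.span_eq_bot]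
    rintro _ ⟨s, hs, rfl⟩
    have := degree_add_degree_rev hD s
    rw [Set.mem_ofPred_eq] at hs
    lia
  · rw [quotientComponent_eq_span_monomialBasis hα hd hd0 hc,
      quotientComponent_eq_span_monomialBasis hα hd hd0 hc]
    exact (finrank_span_box_eq_of_add_eq _ hD (by lia)).le

end Nondegenerate

lemma pos_of_binomialIdeal_ne_top (hd : d 0 = ∑ j : Fin m, α j.succ) (hdeg : d 0 = 0 → c ≠ -1)
    (hK : binomialIdeal d α c ≠ ⊤) : 0 < d 0 := by
  refine Nat.pos_of_ne_zero fun h0 => ?_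
  have htail : tailExp α = 0 := by
    rw [← degree_eq_zero_iff, degree_tailExp, ← hd, h0]
  have hmem : C (1 + c) ∈ binomialIdeal d α c := by
    rw [binomialIdeal_eq_span]
    refine Ideal.subset_span (Or.inl (Or.inl ?_))
    rw [h0, htail, single_zero, Set.mem_singleton_iff, monomial_zero', ← C_mul, mul_one, C_add]
  have hunit : IsUnit (1 + c) := IsUnit.mk0 _ fun h => hdeg h0 (eq_neg_of_add_eq_zero_right h)
  exact hK (Ideal.eq_top_of_isUnit_mem _ hmem (hunit.map C))

end Lefschetz

theorem theorem3p2 {k : Type u} [Field k] [CharZero k] {m : ℕ} (d α : Fin (m + 1) → ℕ) (c : k)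
    (hα : ∀ i, α i ≤ d i) (hd : d 0 = ∑ j : Fin m, α j.succ) (hc : c ≠ 0)
    (hdeg : d 0 = 0 → c ≠ -1) (hK : binomialIdeal d α c ≠ ⊤) :
    IsGorensteinRing (MvPolynomial (Fin (m + 1)) k ⧸ binomialIdeal d α c) ∧
      HasSLP (binomialIdeal d α c) := by
  have hd0 : 0 < d 0 := pos_of_binomialIdeal_ne_top hd hdeg hK
  exact ⟨isGorensteinRing_quotient_binomialIdeal hα hd hd0 hc,
    hasSLP_binomialIdeal hα hd hd0 hc hK⟩
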